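/- Let $E_0$ be the equivalence relation of eventual equality on $2^{\omega}$, and let $\Gamma$ be a countably infinite group. Let $E_0^{[\Gamma]}$ be the $\Gamma$-jump of $E_0$, i.e. the equivalence relation on $(2^{\omega})^{\Gamma}$ given by \[ x \mathrel{E_0^{[\Gamma]}} y \iff (\exists \gamma\in\Gamma)(\forall \alpha\in\Gamma)\; x(\gamma^{-1}\alpha) \mathrel{E_0} y(\alpha). \] Let $E_\infty$ be a universal countable Borel equivalence relation on a standard Borel space $Y$, i.e. a Borel equivalence relation with countable classes to which every countable Borel equivalence relation on a standard Borel space is Borel reducible; the usual concrete model of $E_\infty$, the orbit equivalence relation of the shift action of the free group $F_2$ on $2^{F_2}$, is included. Let $E_\infty^{\omega}$ be its countable power on $Y^\omega$: $(y_n) \mathrel{E_\infty^\omega} (z_n)$ if and only if $y_n \mathrel{E_\infty} z_n$ for all $n$. Then $E_0^{[\Gamma]}$ is generically $E_\infty$-ergodic and generically $E_\infty^\omega$-ergodic. That is, for $F=E_\infty$ and for $F = E_\infty^\omega$: whenever $\varphi$ is a Baire-measurable map on $(2^\omega)^\Gamma$ with $x \mathrel{E_0^{[\Gamma]}} x' \Rightarrow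 \varphi(x) \mathrel{F} \varphi(x')$, there is a $y$ such that $\{x : \varphi(x) \mathrel{F} y\}$ is comeager in $(2^\omega)^\Gamma$. -/

import Mathlib

open Filter Topology MeasureTheory

namespace BernoulliJump

/-- The equivalence relation `E₀` of eventual equality on the Cantor space `2^ω`. -/
def E0 : Setoid (ℕ → Bool) where
  r x y := ∃ N : ℕ, ∀ n : ℕ, N ≤ n → x n = y n
  iseqv :=
    { refl := fun _ => ⟨0, fun _ _ => rfl⟩
      symm := fun ⟨N, h⟩ => ⟨N, fun n hn => (h n hn).symm⟩
      trans := fun ⟨N, h⟩ ⟨M, k⟩ => ⟨max N M, fun n hn =>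
        (h n (le_trans (le_max_left N M) hn)).trans (k n (le_trans (le_max_right N M) hn))⟩ }

/-- The `Γ`-jump `E^{[Γ]}` of an equivalence relation `E` on `X`, living on `X^Γ`. -/
def gammaJump (Γ : Type*) [Group Γ] {X : Type*} (E : Setoid X) : Setoid (Γ → X) where
  r x y := ∃ γ : Γ, ∀ α : Γ, E.r (x (γ⁻¹ * α)) (y α)
  iseqv :=
    { refl := fun x => ⟨1, fun α => by
        rw [inv_one, one_mul]⟩
      symm := fun {x y} ⟨γ, h⟩ => ⟨γ⁻¹, fun α => by
        have h1 := h (γ * α)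
        rw [inv_mul_cancel_left] at h1
        rw [inv_inv]
        exact E.iseqv.symm h1⟩
      trans := fun {x y z} ⟨γ, h⟩ ⟨δ, k⟩ => ⟨δ * γ, fun α => by
        have h1 := h (δ⁻¹ * α)
        rw [← mul_assoc, ← mul_inv_rev] at h1
        exact E.iseqv.trans h1 (k α)⟩ }

/-- The countable power `F^ω` of an equivalence relation `F` on `Y`, living on `Y^ω`. -/
def omegaPower {Y : Type*} (F : Setoid Y) : Setoid (ℕ → Y) where
  r x y := ∀ n : ℕ, F.r (x n) (y n)
  iseqv :=
    { refl := fun x n => F.iseqv.refl (x n)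
      symm := fun h n => F.iseqv.symm (h n)
      trans := fun h k n => F.iseqv.trans (h n) (k n) }

/-- `φ` is a homomorphism from `E` to `F`. -/
def IsHom {X Y : Type*} (E : Setoid X) (F : Setoid Y) (φ : X → Y) : Prop :=
  ∀ x x' : X, E.r x x' → F.r (φ x) (φ x')

/-- `φ` is Baire measurable: preimages of Borel sets have the property of Baire. -/
def BaireMeasurable {X Y : Type*} [TopologicalSpace X] [MeasurableSpace Y] (φ : X → Y) : Prop :=
  ∀ s : Set Y, MeasurableSet s → BaireMeasurableSet (φ ⁻¹' s)

/-- `E` is generically `F`-ergodic: for every Baire measurable homomorphism `φ` from `E` to `F`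
the preimage of some single `F`-class is comeager. -/
def GenericallyErgodic {X Y : Type*} [TopologicalSpace X] [MeasurableSpace Y]
    (E : Setoid X) (F : Setoid Y) : Prop :=
  ∀ φ : X → Y, BaireMeasurable φ → IsHom E F φ →
    ∃ y : Y, {x : X | F.r (φ x) y} ∈ residual X

/-- `E ≤_B F`: there is a Borel reduction from `E` to `F`. -/
def BorelReducible {X Y : Type*} [MeasurableSpace X] [MeasurableSpace Y]
    (E : Setoid X) (F : Setoid Y) : Prop :=
  ∃ f : X → Y, Measurable f ∧ ∀ x x' : X, E.r x x' ↔ F.r (f x) (f x')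

/-- A countable Borel equivalence relation: Borel as a subset of the square, with all classes
countable. -/
def IsCountableBorel {Y : Type*} [MeasurableSpace Y] (F : Setoid Y) : Prop :=
  MeasurableSet {p : Y × Y | F.r p.1 p.2} ∧ ∀ y : Y, {z : Y | F.r y z}.Countable

/-- A universal countable Borel equivalence relation, that is, a realization of `E_∞`: it is a
countable Borel equivalence relation to which every countable Borel equivalence relation on a
standard Borel space is Borel reducible. (Every standard Borel space is Borel isomorphic to one
in `Type`, so that testing on spaces in `Type` is no restriction.) -/
def IsUniversalCountableBorel {Y : Type*} [MeasurableSpace Y] (F : Setoid Y) : Prop :=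
  IsCountableBorel F ∧
    ∀ (Z : Type) [MeasurableSpace Z] [StandardBorelSpace Z] (E : Setoid Z),
      IsCountableBorel E → BorelReducible E F

/-- The usual concrete model of `E_∞`: the orbit equivalence relation of the Bernoulli shift of
the free group on two generators on `2^{F₂}`, i.e. the `F₂`-jump of equality on two points. -/
def EInfty : Setoid (FreeGroup (Fin 2) → Bool) :=
  gammaJump (FreeGroup (Fin 2)) (⊥ : Setoid Bool)

end BernoulliJump

namespace BernoulliJump

/-! Let `F` have countable classes. For generic `x`, flipping finitely many digits in each
coordinate gives a map `w ↦ φ (flips w x)` from `Γ → ℕ` into one countable class. By Baire category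
it is generically constant on some open set of `w`, which restricts only finitely many coordinates.
Hence on some open box `O`, at generic points, `φ x` depends only on `x` restricted to a finite `L`
(`exists_open_finite_dependence`). Choose `γ` with `γ⁻¹L` disjoint from `L`, and let `σ` be the
shift by `γ`. If `x`, `y` and their shifts lie in `O`, let `s` be `x` on `L` and `y` elsewhere.
Generically `φ x = φ s`, `φ s` is `F`-related to `φ (σ s) = φ (σ y)`, and this to `φ y`. Dense flip
orbits spread this one class to a comeager set. Powers are handled coordinatewise. -/

open Set

/-! ### Category tools. -/

/-- A Kuratowski–Ulam type theorem: if the preimages of dense open sets under `f` are dense in the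
sense of `hd`, then the preimage of a comeager set has comeagerly many comeager sections. -/
theorem eventually_residual_sections {P Q X : Type*} [TopologicalSpace P] [TopologicalSpace Q]
    [TopologicalSpace X] [SecondCountableTopology P] {f : P → Q → X}
    (hf₁ : ∀ q, Continuous fun p => f p q) (hf₂ : ∀ p, Continuous (f p))
    (hd : ∀ G : Set X, IsOpen G → Dense G → ∀ B : Set P, IsOpen B → B.Nonempty →
      Dense {q | ∃ p ∈ B, f p q ∈ G})
    {D : Set X} (hD : D ∈ residual X) : ∀ᶠ q in residual Q, ∀ᶠ p in residual P, f p q ∈ D := by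
  obtain ⟨S, hSo, hSd, hSc, hSD⟩ := mem_residual_iff.1 hD
  have key : ∀ G ∈ S, ∀ᶠ q in residual Q, ∀ᶠ p in residual P, f p q ∈ G := by
    intro G hG
    have h : ∀ B ∈ TopologicalSpace.countableBasis P, ∀ᶠ q in residual Q, ∃ p ∈ B, f p q ∈ G := by
      intro B hB
      refine residual_of_dense_open ?_ (hd G (hSo G hG) (hSd G hG) B
        (TopologicalSpace.isOpen_of_mem_countableBasis hB)
        (TopologicalSpace.nonempty_of_mem_countableBasis hB))
      have : {q | ∃ p ∈ B, f p q ∈ G} = ⋃ p ∈ B, f p ⁻¹' G := by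
        ext q; simp
      rw [this]
      exact isOpen_biUnion fun p _ => (hSo G hG).preimage (hf₂ p)
    filter_upwards [(eventually_countable_ball
      (TopologicalSpace.countable_countableBasis P)).2 h] with q hq
    refine residual_of_dense_open ((hSo G hG).preimage (hf₁ q)) ?_
    rw [(TopologicalSpace.isBasis_countableBasis P).dense_iff]
    intro B hB _
    obtain ⟨p, hp, hpG⟩ := hq B hB
    exact ⟨p, hp, hpG⟩
  filter_upwards [(eventually_countable_ball hSc).2 key] with q hq
  filter_upwards [(eventually_countable_ball hSc).2 hq] with p hp
  exact hSD fun G hG => hp G hG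

/-- If countably many closed sets cover a comeager set, then one of them has interior. -/
theorem exists_nonempty_interior_of_eventually {X ι : Type*} [TopologicalSpace X] [BaireSpace X]
    [Nonempty X] [Countable ι] {P : ι → Set X} (hP : ∀ i, IsClosed (P i))
    (h : ∀ᶠ x in residual X, ∃ i, x ∈ P i) : ∃ i, (interior (P i)).Nonempty := by
  by_contra! hcon
  have h' : ∀ᶠ x in residual X, ∀ i, x ∉ P i := by
    refine eventually_countable_forall.2 fun i => ?_
    exact residual_of_dense_open (hP i).isOpen_compl (interior_eq_empty_iff_dense_compl.1 (hcon i))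
  obtain ⟨x, ⟨i, hi⟩, hx⟩ := (dense_of_mem_residual (h.and h')).nonempty
  exact hx i hi

/-! ### The flip action. -/

/-- Flip those digits of `x` whose positions are binary digits of `k`. -/
def flip (k : ℕ) (x : ℕ → Bool) : ℕ → Bool := fun n => xor (x n) (k.testBit n)

theorem flip_flip (k : ℕ) (x : ℕ → Bool) : flip k (flip k x) = x := by
  funext n; simp [flip]

theorem continuous_flip (k : ℕ) : Continuous (flip k) :=
  continuous_pi fun n => (continuous_of_discreteTopology (f := fun b => xor b (k.testBit n))).comp
    (continuous_apply n)

theorem E0_flip (k : ℕ) (x : ℕ → Bool) : E0.r (flip k x) x := by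
  -- Since `k < 2 ^ k`, no binary digit of `k` sits at a position `≥ k`.
  refine ⟨k, fun n hn => ?_⟩
  have : k.testBit n = false :=
    Nat.testBit_lt_two_pow (lt_of_le_of_lt hn Nat.lt_two_pow_self)
  simp [flip, this]

theorem exists_flip_eq (x y : ℕ → Bool) (m : ℕ) : ∃ k, ∀ n < m, flip k x n = y n := by
  refine ⟨Nat.ofBits fun i : Fin m => xor (x i) (y i), fun n hn => ?_⟩
  simp [flip, hn]

variable {Γ : Type*}

/-- The coordinatewise action of `ℕ^Γ` on `(2^ω)^Γ` by flips. -/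
def flips (w : Γ → ℕ) (x : Γ → ℕ → Bool) : Γ → ℕ → Bool := fun α => flip (w α) (x α)

theorem flips_flips (w : Γ → ℕ) (x : Γ → ℕ → Bool) : flips w (flips w x) = x :=
  funext fun _ => flip_flip _ _

theorem continuous_flips (w : Γ → ℕ) : Continuous (flips w) :=
  continuous_pi fun α => (continuous_flip (w α)).comp (continuous_apply α)

theorem continuous_flips_left (x : Γ → ℕ → Bool) : Continuous fun w => flips w x :=
  continuous_pi fun α => (continuous_of_discreteTopology (f := fun k => flip k (x α))).comp
    (continuous_apply α)

theorem dense_preimage_flips (w : Γ → ℕ) {G : Set (Γ → ℕ → Bool)} (hG : Dense G) :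
    Dense (flips w ⁻¹' G) :=
  hG.preimage (Homeomorph.isOpenMap
    { toFun := flips w
      invFun := flips w
      left_inv := flips_flips w
      right_inv := flips_flips w
      continuous_toFun := continuous_flips w
      continuous_invFun := continuous_flips w })

theorem gammaJump_flips [Group Γ] (w : Γ → ℕ) (x : Γ → ℕ → Bool) :
    (gammaJump Γ E0).r x (flips w x) :=
  ⟨1, fun α => by
    rw [inv_one, one_mul]
    exact E0.iseqv.symm (E0_flip _ _)⟩

theorem eventually_eventually_flips [Countable Γ] {D : Set (Γ → ℕ → Bool)}
    (hD : D ∈ residual (Γ → ℕ → Bool)) :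
    ∀ᶠ x in residual (Γ → ℕ → Bool), ∀ᶠ w in residual (Γ → ℕ), flips w x ∈ D := by
  refine eventually_residual_sections continuous_flips_left continuous_flips ?_ hD
  rintro G - hG B - ⟨w, hw⟩
  exact (dense_preimage_flips w hG).mono fun x hx => ⟨w, hw, hx⟩

/-! ### Splicing two points. -/

open Classical in
/-- The point which agrees with `x` on `L` and with `y` elsewhere. -/
noncomputable def splice (L : Finset Γ) (x y : Γ → ℕ → Bool) : Γ → ℕ → Bool :=
  fun α => if α ∈ L then x α else y α

theorem splice_of_mem {L : Finset Γ} {α : Γ} (h : α ∈ L) (x y : Γ → ℕ → Bool) :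
    splice L x y α = x α := by simp [splice, h]

theorem splice_of_notMem {L : Finset Γ} {α : Γ} (h : α ∉ L) (x y : Γ → ℕ → Bool) :
    splice L x y α = y α := by simp [splice, h]

theorem continuous_splice_left (L : Finset Γ) (y : Γ → ℕ → Bool) :
    Continuous fun x => splice L x y := by
  refine continuous_pi fun α => ?_
  by_cases h : α ∈ L
  · simpa only [splice_of_mem h] using continuous_apply α
  · simpa only [splice_of_notMem h] using continuous_const

theorem continuous_splice_right (L : Finset Γ) (x : Γ → ℕ → Bool) : Continuous (splice L x) := by
  refine continuous_pi fun α => ?_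
  by_cases h : α ∈ L
  · simpa only [splice_of_mem h] using continuous_const
  · simpa only [splice_of_notMem h] using continuous_apply α

theorem eventually_eventually_splice [Countable Γ] (L : Finset Γ) {D : Set (Γ → ℕ → Bool)}
    (hD : D ∈ residual (Γ → ℕ → Bool)) :
    ∀ᶠ y in residual (Γ → ℕ → Bool), ∀ᶠ x in residual (Γ → ℕ → Bool), splice L x y ∈ D := by
  refine eventually_residual_sections (continuous_splice_left L) (continuous_splice_right L) ?_ hD
  rintro G - hG B hB ⟨b, hb⟩
  rw [dense_iff_inter_open]
  rintro C hC ⟨c, hc⟩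
  have h₁ : splice L (splice L b c) b = b := by
    funext α
    by_cases h : α ∈ L <;> simp [splice, h]
  have h₂ : splice L c (splice L b c) = c := by
    funext α
    by_cases h : α ∈ L <;> simp [splice, h]
  -- Take `z ∈ G` whose part on `L`, completed by `b`, lies in `B`, and whose part off `L`,
  -- completed by `c`, lies in `C`; splicing these completions returns `z`.
  obtain ⟨z, ⟨hzB, hzC⟩, hzG⟩ := hG.inter_open_nonempty
    ((fun z => splice L z b) ⁻¹' B ∩ splice L c ⁻¹' C)
    ((hB.preimage (continuous_splice_left L b)).inter (hC.preimage (continuous_splice_right L c)))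
    ⟨splice L b c, by simpa [h₁] using hb, by simpa [h₂] using hc⟩
  refine ⟨splice L c z, hzC, splice L z b, hzB, ?_⟩
  convert hzG using 1
  funext α
  by_cases h : α ∈ L <;> simp [splice, h]

/-! ### Finite dependence. -/

/-- A family of pairs of open sets which is not split by the flips, from a nonempty open set, of a generic
point is not split, locally, by pairs of points agreeing on some finite set of coordinates. -/
theorem exists_open_finite_dependence [Countable Γ] {U V : ℕ → Set (Γ → ℕ → Bool)}
    (hU : ∀ n, IsOpen (U n)) (hV : ∀ n, IsOpen (V n))
    (h : ∀ᶠ x in residual (Γ → ℕ → Bool), ∃ N : Set (Γ → ℕ), IsOpen N ∧ N.Nonempty ∧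
      ∀ w ∈ N, ∀ w' ∈ N, ∀ n, ¬(flips w x ∈ U n ∧ flips w' x ∈ V n)) :
    ∃ (L : Finset Γ) (v : Γ → Set (ℕ → Bool)), (∀ α ∈ L, IsOpen (v α)) ∧
      (∃ p : Γ → ℕ → Bool, ∀ α ∈ L, p α ∈ v α) ∧
      ∀ z z' : Γ → ℕ → Bool, (∀ α ∈ L, z α ∈ v α) → (∀ α ∈ L, z α = z' α) →
        ∀ n, ¬(z ∈ U n ∧ z' ∈ V n) := by
  classical
  let P : TopologicalSpace.countableBasis (Γ → ℕ) → Set (Γ → ℕ → Bool) := fun N =>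
    ⋂ w ∈ N.1, ⋂ w' ∈ N.1, ⋂ n, (flips w ⁻¹' U n ∩ flips w' ⁻¹' V n)ᶜ
  have hPc : ∀ N, IsClosed (P N) := fun N =>
    isClosed_biInter fun w _ => isClosed_biInter fun w' _ => isClosed_iInter fun n =>
      (((hU n).preimage (continuous_flips w)).inter
        ((hV n).preimage (continuous_flips w'))).isClosed_compl
  have hcov : ∀ᶠ x in residual (Γ → ℕ → Bool), ∃ N, x ∈ P N := by
    filter_upwards [h] with x ⟨N, hNo, ⟨w₀, hw₀⟩, hN⟩
    obtain ⟨N', hN', -, hsub⟩ :=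
      (TopologicalSpace.isBasis_countableBasis (Γ → ℕ)).exists_subset_of_mem_open hw₀ hNo
    refine ⟨⟨N', hN'⟩, ?_⟩
    simp only [P, mem_iInter]
    exact fun w hw w' hw' n => hN w (hsub hw) w' (hsub hw') n
  have : Countable (TopologicalSpace.countableBasis (Γ → ℕ)) :=
    (TopologicalSpace.countable_countableBasis _).to_subtype
  obtain ⟨N, p₀, hp₀⟩ := exists_nonempty_interior_of_eventually hPc hcov
  obtain ⟨w₀, hw₀⟩ := TopologicalSpace.nonempty_of_mem_countableBasis N.2
  obtain ⟨K, t, ht, htN⟩ := isOpen_pi_iff.1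
    (TopologicalSpace.isOpen_of_mem_countableBasis N.2) w₀ hw₀
  obtain ⟨I, u, hu, huP⟩ := isOpen_pi_iff.1 isOpen_interior p₀ hp₀
  -- The box around `p₀` inside the interior of `P N`, moved by `w₀`: `z` in it gives `flips w₀ z ∈
  -- P N`.
  let v : Γ → Set (ℕ → Bool) := fun α => if α ∈ I then flip (w₀ α) ⁻¹' u α else univ
  refine ⟨K ∪ I, v, ?_, ⟨flips w₀ p₀, ?_⟩, ?_⟩
  · intro α _
    by_cases hα : α ∈ I
    · simpa [v, hα] using (hu α hα).1.preimage (continuous_flip _)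
    · simp [v, hα]
  · intro α _
    by_cases hα : α ∈ I
    · simpa [v, hα, flips, flip_flip] using (hu α hα).2
    · simp [v, hα]
  · rintro z z' hz hzz' n ⟨hzU, hzV⟩
    have hxP : flips w₀ z ∈ P N := by
      refine interior_subset (huP fun α hα => ?_)
      have hα : α ∈ I := hα
      simpa [v, hα, flips] using hz α (Finset.mem_union_right _ hα)
    choose k hk using fun (m : ℕ) (α : Γ) => exists_flip_eq (flips w₀ z α) (z' α) m
    -- Equal to `w₀` on `K`, so in `N`. Although `z'` need not be in the flip orbit of `z`, it is a
    -- limit of such flips, which suffices because `V n` is open.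
    let w : ℕ → Γ → ℕ := fun m α => if α ∈ K ∪ I then w₀ α else k m α
    have hlim : Tendsto (fun m => flips (w m) (flips w₀ z)) atTop (𝓝 z') := by
      refine tendsto_pi_nhds.2 fun α => tendsto_pi_nhds.2 fun i => ?_
      refine tendsto_const_nhds.congr' ?_
      filter_upwards [eventually_gt_atTop i] with m hm
      by_cases hα : α ∈ K ∪ I
      · have : flips (w m) (flips w₀ z) α = z α := by
          simp only [flips, w, if_pos hα, flip_flip]
        rw [this, hzz' α hα]
      · have : flips (w m) (flips w₀ z) α = flip (k m α) (flips w₀ z α) := by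
          simp only [flips, w, if_neg hα]
        rw [this, hk m α i hm]
    obtain ⟨m, hm⟩ := (hlim.eventually ((hV n).mem_nhds hzV)).exists
    have hwN : w m ∈ N.1 := by
      refine htN fun α hα => ?_
      have hα' : α ∈ K ∪ I := Finset.mem_union_left _ hα
      simpa only [w, if_pos hα'] using (ht α hα).2
    simp only [P, mem_iInter] at hxP
    exact hxP w₀ hw₀ (w m) hwN n ⟨by simpa [flips_flips] using hzU, hm⟩

theorem exists_disjoint_translate [Group Γ] [Infinite Γ] (L : Finset Γ) :
    ∃ γ : Γ, ∀ α ∈ L, γ⁻¹ * α ∉ L := by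
  classical
  -- Avoid the finite set `L * L⁻¹`.
  obtain ⟨γ, hγ⟩ := Infinite.exists_notMem_finset ((L ×ˢ L).image fun p => p.1 * p.2⁻¹)
  refine ⟨γ, fun α hα h => hγ ?_⟩
  exact Finset.mem_image.2 ⟨(α, γ⁻¹ * α), Finset.mem_product.2 ⟨hα, h⟩, by simp⟩

/-! ### Ergodicity for countable classes. -/

theorem genericallyErgodic_of_countable_classes [Group Γ] [Countable Γ] [Infinite Γ] {Y : Type*}
    [MeasurableSpace Y] [MeasurableSpace.CountablySeparated Y] (F : Setoid Y)
    (hF : ∀ y : Y, {z : Y | F.r y z}.Countable) :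
    GenericallyErgodic (gammaJump Γ E0) F := by
  intro φ hφ hhom
  obtain ⟨B, hBm, hB⟩ := exists_seq_separating Y (p := MeasurableSet) MeasurableSet.empty univ
  choose U hUo hU using fun n => (hφ (B n) (hBm n)).residualEq_isOpen
  choose V hVo hV using fun n => (hφ (B n) (hBm n)).compl.residualEq_isOpen
  obtain ⟨D, hD, hDU, hDV⟩ : ∃ D ∈ residual (Γ → ℕ → Bool),
      (∀ x ∈ D, ∀ n, φ x ∈ B n ↔ x ∈ U n) ∧ (∀ x ∈ D, ∀ n, φ x ∉ B n ↔ x ∈ V n) :=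
    ⟨_, (eventually_countable_forall.2 fun n => eventuallyEq_set.1 (hU n)).and
      (eventually_countable_forall.2 fun n => eventuallyEq_set.1 (hV n)),
      fun x hx n => hx.1 n, fun x hx n => hx.2 n⟩
  have hflips : ∀ w x, F.r (φ x) (φ (flips w x)) := fun w x => hhom _ _ (gammaJump_flips w x)
  obtain ⟨L, v, hvo, ⟨p, hp⟩, hL⟩ := exists_open_finite_dependence hUo hVo (by
    filter_upwards [eventually_eventually_flips hD] with x hx
    have : Countable {z : Y | F.r (φ x) z} := (hF (φ x)).to_subtype
    -- A closed substitute for `{w | φ (flips w x) = y}`, containing each of its `w` with `flips w x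
    -- ∈ D`.
    let C : {z : Y | F.r (φ x) z} → Set (Γ → ℕ) := fun y =>
      {w | ∀ n, (y.1 ∈ B n → flips w x ∉ V n) ∧ (y.1 ∉ B n → flips w x ∉ U n)}
    have hC : ∀ y, IsClosed (C y) := by
      intro y
      have : C y = ⋂ n, {w | y.1 ∈ B n → flips w x ∉ V n} ∩ {w | y.1 ∉ B n → flips w x ∉ U n} := by
        ext w; simp [C]
      rw [this]
      refine isClosed_iInter fun n => IsClosed.inter ?_ ?_
      · exact isClosed_imp isOpen_const
          ((hVo n).preimage (continuous_flips_left x)).isClosed_compl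
      · exact isClosed_imp isOpen_const
          ((hUo n).preimage (continuous_flips_left x)).isClosed_compl
    obtain ⟨y, hy⟩ := exists_nonempty_interior_of_eventually hC (by
      filter_upwards [hx] with w hw
      refine ⟨⟨φ (flips w x), hflips w x⟩, fun n => ⟨fun h h' => ?_, fun h h' => ?_⟩⟩
      · exact (hDV _ hw n).2 h' h
      · exact h ((hDU _ hw n).2 h'))
    refine ⟨interior (C y), isOpen_interior, hy, fun w hw w' hw' n h => ?_⟩
    by_cases hyB : y.1 ∈ B n
    · exact (interior_subset hw' n).1 hyB h.2
    · exact (interior_subset hw n).2 hyB h.1)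
  have hconst : ∀ z ∈ D, ∀ z' ∈ D, (∀ α ∈ L, z α ∈ v α) → (∀ α ∈ L, z α = z' α) →
      φ z = φ z' := by
    intro z hz z' hz' hzv hzz'
    refine hB _ (mem_univ _) _ (mem_univ _) fun n => ⟨fun h => ?_, fun h => ?_⟩
    · by_contra h'
      exact hL z z' hzv hzz' n ⟨(hDU z hz n).1 h, (hDV z' hz' n).1 h'⟩
    · by_contra h'
      exact hL z' z (fun α hα => hzz' α hα ▸ hzv α hα) (fun α hα => (hzz' α hα).symm) n
        ⟨(hDU z' hz' n).1 h, (hDV z hz n).1 h'⟩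
  obtain ⟨γ, hγ⟩ := exists_disjoint_translate L
  let σ : (Γ → ℕ → Bool) ≃ₜ (Γ → ℕ → Bool) :=
    Homeomorph.piCongrLeft (Y := fun _ : Γ => ℕ → Bool) (Equiv.mulLeft γ)
  have hσ : ∀ x α, σ x α = x (γ⁻¹ * α) := by
    intro x α
    obtain ⟨β, rfl⟩ := (Equiv.mulLeft γ).surjective α
    rw [Homeomorph.piCongrLeft_apply_apply]
    simp
  have hφσ : ∀ x, F.r (φ x) (φ (σ x)) := fun x => hhom _ _ ⟨γ, fun α => by rw [hσ]⟩
  have hDσ : ∀ᶠ x in residual (Γ → ℕ → Bool), x ∈ D ∧ σ x ∈ D :=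
    Filter.Eventually.and hD ((tendsto_residual_of_isOpenMap σ.continuous σ.isOpenMap) hD)
  let O : Set (Γ → ℕ → Bool) := (L : Set Γ).pi v
  have hO : IsOpen O := isOpen_set_pi L.finite_toSet hvo
  let Q : Set (Γ → ℕ → Bool) := O ∩ σ ⁻¹' O
  have hQ : IsOpen Q := hO.inter (hO.preimage σ.continuous)
  have hQne : Q.Nonempty := by
    -- `L` and `γ⁻¹L` are disjoint, so `p` can be prescribed on `L` both before and after the shift.
    refine ⟨splice L p (σ.symm p), fun α hα => ?_, fun α hα => ?_⟩
    · rw [splice_of_mem hα]; exact hp α hα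
    · rw [hσ, splice_of_notMem (hγ α hα), ← hσ (σ.symm p), σ.apply_symm_apply]
      exact hp α hα
  obtain ⟨y, hyQ, hyD, hy⟩ := (dense_of_mem_residual
    (hDσ.and (eventually_eventually_splice L hDσ))).inter_open_nonempty Q hQ hQne
  have hQy : ∀ᶠ x in residual (Γ → ℕ → Bool), x ∈ Q → F.r (φ x) (φ y) := by
    filter_upwards [hDσ, hy] with x hxD hm hxQ
    have h₁ : φ x = φ (splice L x y) := hconst _ hxD.1 _ hm.1 hxQ.1 fun α hα =>
      (splice_of_mem hα x y).symm
    have h₂ : φ (σ y) = φ (σ (splice L x y)) := hconst _ hyD.2 _ hm.2 hyQ.2 fun α hα => by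
      rw [hσ, hσ, splice_of_notMem (hγ α hα)]
    rw [h₁]
    refine F.iseqv.trans (hφσ _) ?_
    rw [← h₂]
    exact F.iseqv.symm (hφσ y)
  refine ⟨φ y, ?_⟩
  filter_upwards [eventually_eventually_flips hQy] with x hx
  -- Every flip orbit is dense, so it meets the open set `Q`.
  have hne : {w | flips w x ∈ Q}.Nonempty := by
    obtain ⟨q, hq⟩ := hQne
    choose k hk using fun (m : ℕ) (α : Γ) => exists_flip_eq (x α) (q α) m
    have hlim : Tendsto (fun m => flips (k m) x) atTop (𝓝 q) := by
      refine tendsto_pi_nhds.2 fun α => tendsto_pi_nhds.2 fun i => ?_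
      refine tendsto_const_nhds.congr' ?_
      filter_upwards [eventually_gt_atTop i] with m hm
      exact (hk m α i hm).symm
    obtain ⟨m, hm⟩ := (hlim.eventually (hQ.mem_nhds hq)).exists
    exact ⟨k m, hm⟩
  obtain ⟨w, hwQ, hw⟩ := (dense_of_mem_residual hx).inter_open_nonempty _
    (hQ.preimage (continuous_flips_left x)) hne
  exact F.iseqv.trans (hflips w x) (hw hwQ)

/-- Generic ergodicity passes to the countable power of the target. -/
theorem GenericallyErgodic.omegaPower {X Y : Type*} [TopologicalSpace X] [MeasurableSpace Y]
    {E : Setoid X} {F : Setoid Y} (h : GenericallyErgodic E F) :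
    GenericallyErgodic E (omegaPower F) := by
  intro φ hφ hhom
  choose y hy using fun n => h (fun x => φ x n)
    (fun s hs => hφ _ (measurable_pi_apply n hs)) (fun x x' hxx' => hhom x x' hxx' n)
  exact ⟨y, eventually_countable_forall.2 hy⟩

theorem countable_gammaJump_bot_class (Δ : Type*) [Group Δ] [Countable Δ] {X : Type*}
    (y : Δ → X) : {z | (gammaJump Δ (⊥ : Setoid X)).r y z}.Countable := by
  refine (countable_range fun (γ : Δ) (α : Δ) => y (γ⁻¹ * α)).mono ?_
  rintro z ⟨γ, hγ⟩
  exact ⟨γ, funext hγ⟩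

end BernoulliJump

theorem theorem4 (Γ : Type*) [Group Γ] [Countable Γ] [Infinite Γ] :
    (BernoulliJump.GenericallyErgodic
        (BernoulliJump.gammaJump Γ BernoulliJump.E0) BernoulliJump.EInfty ∧
      BernoulliJump.GenericallyErgodic
        (BernoulliJump.gammaJump Γ BernoulliJump.E0)
        (BernoulliJump.omegaPower BernoulliJump.EInfty)) ∧
    ∀ (Y : Type*) [MeasurableSpace Y] [StandardBorelSpace Y] (F : Setoid Y),
      BernoulliJump.IsUniversalCountableBorel F →
        BernoulliJump.GenericallyErgodic (BernoulliJump.gammaJump Γ BernoulliJump.E0) F ∧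
        BernoulliJump.GenericallyErgodic (BernoulliJump.gammaJump Γ BernoulliJump.E0)
          (BernoulliJump.omegaPower F) := by
  have hE : BernoulliJump.GenericallyErgodic
      (BernoulliJump.gammaJump Γ BernoulliJump.E0) BernoulliJump.EInfty :=
    BernoulliJump.genericallyErgodic_of_countable_classes _
      (BernoulliJump.countable_gammaJump_bot_class _)
  refine ⟨⟨hE, hE.omegaPower⟩, fun Y _ _ F hF => ?_⟩
  have h := BernoulliJump.genericallyErgodic_of_countable_classes (Γ := Γ) F hF.1.2
  exact ⟨h, h.omegaPower⟩
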